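/- Fix $p\in(1,2)$, a matrix $A\in\mathbb R^{d\times d}$ all of whose eigenvalues have negative real parts, and globally Lipschitz maps $f:\mathbb R^d\to\mathbb R^d$, $g:\mathbb R^d\to\mathbb R^{d\times m}$ with Lipschitz constants $C_f,C_g$, where $g\in C^1$ has a globally Lipschitz derivative. Write $|\!|\!|x|\!|\!|_{p\text{-var},[a,b]}$ for the $p$-variation seminorm, i.e. the $p$-th root of $\sup\sum_i\|x_{t_{i+1}}-x_{t_i}\|^p$ over finite partitions of $[a,b]$, and let $|A|$ be the operator norm. Let $C_A\ge 1$, $\lambda_A>0$ be constants such that $\Phi(t)=e^{At}$ satisfies $\|\Phi\|_{\infty,[a,b]}\le C_Ae^{-\lambda_Aa}$ and $|\!|\!|\Phi|\!|\!|_{p\text{-var},[a,b]}\le|A|C_Ae^{-\lambda_Aa}(b-a)$ for all $0\le a<b$. Put $$L=|A|+C_f,\quad \lambda=\lambda_A-C_AC_f,\quad K=(1-2^{1-2/p})^{-1},\quad \alpha=\log\Big(1+\frac1{K+1}\Big),\quad M_1=KC_Ae^{\lambda_A}(1+|A|).$$ Let $\Omega=C^{0,p\text{-var}}_0(\mathbb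 R,\mathbb R^m)$ be the space of continuous paths $x:\mathbb R\to\mathbb R^m$ with $x_0=0$ whose restriction to every compact interval $[a,b]$ lies in the closure of $C^\infty([a,b],\mathbb R^m)$ in the $p$-variation norm $\|x\|_{p\text{-var},[a,b]}=\|x_a\|+|\!|\!|x|\!|\!|_{p\text{-var},[a,b]}$, with the metric $d_p(x,y)=\sum_{k\ge1}2^{-k}(\|x-y\|_{p\text{-var},[-k,k]}\wedge1)$, its Borel $\sigma$-algebra and the Wiener shift $(\theta_tx)_u=x_{t+u}-x_t$. Let $\mathbb P$ be a probability measure on $\Omega$ that is invariant and ergodic under $(\theta_t)_{t\in\mathbb R}$ and satisfies $\Gamma(p):=\big(\mathbb E|\!|\!|x|\!|\!|^p_{p\text{-var},[-1,1]}\big)^{1/p}<\infty$. With $\kappa=2(K+1)C_g$ and $|\!|\!|x|\!|\!|=|\!|\!|x|\!|\!|_{p\text{-var},[a,b]}$ define $$F(x,[a,b])=\exp\{\alpha(1+\kappa^p|\!|\!|x|\!|\!|^p)+2L(b-a)\},\qquad \Lambda_1(x,[a,b])=(1+\kappa^{p-1}|\!|\!|x|\!|\!|^{p-1})F(x,[a,b]),$$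 $$\Lambda_2(x,[a,b])=2^{\frac{p-1}p}(1+\kappa^{2p-1}|\!|\!|x|\!|\!|^{2p-1})F(x,[a,b]),$$ $$G(x,[a,b])=|\!|\!|x|\!|\!|\,\Lambda_1(x,[a,b]),\qquad H(x,[a,b])=1+|\!|\!|x|\!|\!|\,(1+\Lambda_2(x,[a,b])),$$ and, with values in $[0,\infty]$, $$b(x)=\sup_{\epsilon\in[0,1]}\sum_{k=1}^\infty e^{-\lambda k}H(\theta_{-k}x,[-\epsilon,1-\epsilon])\prod_{j=1}^{k-1}\Big[1+M_1C_gG(\theta_{-j}x,[-\epsilon,1-\epsilon])\Big],\qquad x\in\Omega.$$ Assume that $$\lambda_A-C_AC_f>C_A(1+|A|)e^{\lambda_A+2(|A|+C_f)}\Big\{[2(K+1)C_g\Gamma(p)]^p+2(K+1)C_g\Gamma(p)\Big\}.$$ Then $b:\Omega\to(0,\infty]$ is measurable, $b(x)<\infty$ almost surely, and $b$ is tempered: almost surely $b(\theta_tx)<\infty$ for all $t\in\mathbb R$ and $$\lim_{t\to\pm\infty}\frac1t\log^+b(\theta_tx)=0.$$ -/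

import Mathlib

open Set Filter Topology MeasureTheory
open scoped NNReal ENNReal

noncomputable section

namespace YoungRDS

/-! ### `p`-variation -/

/-- `⦀x⦀ᵖ` on `[a,b]`: the supremum of `∑ ‖x (t (i+1)) - x (t i)‖ ^ p` over all finite
increasing families of points `t 0 ≤ t 1 ≤ ⋯ ≤ t n` of `[a,b]` (same convention as Mathlib's
`eVariationOn`). Since repeated points contribute `0 ^ p = 0` and adding the end points `a`, `b`
only increases the sum, this is the supremum over the partitions `a = t 0 < ⋯ < t n = b`. -/
def pVarPow {E : Type*} [PseudoEMetricSpace E] (p : ℝ) (x : ℝ → E) (a b : ℝ) : ℝ≥0∞ :=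
  ⨆ q : ℕ × {t : ℕ → ℝ // Monotone t ∧ ∀ i, t i ∈ Icc a b},
    ∑ i ∈ Finset.range q.1, edist (x (q.2.1 (i + 1))) (x (q.2.1 i)) ^ p

/-- The `p`-variation seminorm `⦀x⦀` of the path `x` on `[a,b]`, possibly infinite. -/
def pVar {E : Type*} [PseudoEMetricSpace E] (p : ℝ) (x : ℝ → E) (a b : ℝ) : ℝ≥0∞ :=
  pVarPow p x a b ^ (1 / p)

/-- The `p`-variation norm `‖x a‖ + ⦀x⦀` of the path `x` on `[a,b]`. -/
def pVarNorm {E : Type*} [SeminormedAddCommGroup E] (p : ℝ) (x : ℝ → E) (a b : ℝ) : ℝ≥0∞ :=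
  ‖x a‖ₑ + pVar p x a b

theorem pVarPow_shift_le {E : Type*} [SeminormedAddCommGroup E] (p : ℝ) {x y : ℝ → E} {r : ℝ}
    {c : E} (h : ∀ u, y u = x (r + u) - c) (a b : ℝ) :
    pVarPow p y a b ≤ pVarPow p x (r + a) (r + b) := by
  refine iSup_le fun q => ?_
  refine le_iSup_of_le ⟨q.1, fun i => r + q.2.1 i, ?_, ?_⟩ ?_
  · intro i j hij
    have := q.2.2.1 hij
    simpa using this
  · intro i
    have := q.2.2.2 i
    exact ⟨by linarith [this.1], by linarith [this.2]⟩
  · simp [h]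

theorem pVar_shift {E : Type*} [SeminormedAddCommGroup E] (p : ℝ) {x y : ℝ → E} {r : ℝ}
    {c : E} (h : ∀ u, y u = x (r + u) - c) (a b : ℝ) :
    pVar p y a b = pVar p x (r + a) (r + b) := by
  unfold pVar
  congr 1
  refine le_antisymm (pVarPow_shift_le p h a b) ?_
  have h' : ∀ u, x u = y (-r + u) - (-c) := fun u => by simp [h]
  simpa using pVarPow_shift_le p h' (r + a) (r + b)

/-! ### The path space and the Wiener shift -/

/-- Membership in `C₀^{0,p-var}(ℝ, ℝᵐ)`: continuous paths of finite `p`-variation on compact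
intervals, vanishing at `0`, whose restriction to every compact interval `[a,b]` is a limit, in the
`p`-variation norm, of smooth paths on `[a,b]`. -/
structure IsPath {m : ℕ} (p : ℝ) (x : ℝ → EuclideanSpace ℝ (Fin m)) : Prop where
  continuous : Continuous x
  map_zero : x 0 = 0
  pVar_lt_top : ∀ a b : ℝ, a ≤ b → pVar p x a b < ∞
  smooth_approx : ∀ a b : ℝ, a ≤ b → ∀ ε : ℝ≥0∞, 0 < ε →
    ∃ φ : ℝ → EuclideanSpace ℝ (Fin m),
      ContDiffOn ℝ (⊤ : ℕ∞) φ (Icc a b) ∧ pVarNorm p (x - φ) a b < ε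

/-- The space `Ω = C₀^{0,p-var}(ℝ, ℝᵐ)`. -/
def PathSpace (p : ℝ) (m : ℕ) : Type := {x : ℝ → EuclideanSpace ℝ (Fin m) // IsPath p x}

instance (p : ℝ) (m : ℕ) : CoeFun (PathSpace p m) (fun _ => ℝ → EuclideanSpace ℝ (Fin m)) :=
  ⟨Subtype.val⟩

/-- The metric `d_p(x, y) = ∑_{k ≥ 1} 2⁻ᵏ (‖x - y‖_{p-var,[-k,k]} ∧ 1)`. -/
def pathDist {p : ℝ} {m : ℕ} (x y : PathSpace p m) : ℝ≥0∞ :=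
  ∑' k : ℕ, (2⁻¹ : ℝ≥0∞) ^ (k + 1) *
    min (pVarNorm p (fun u => x u - y u) (-((k : ℝ) + 1)) ((k : ℝ) + 1)) 1

/-- The topology of `Ω` generated by the open balls of `d_p`. -/
instance (p : ℝ) (m : ℕ) : TopologicalSpace (PathSpace p m) :=
  TopologicalSpace.generateFrom {U | ∃ (x : PathSpace p m) (r : ℝ≥0∞), U = {y | pathDist x y < r}}

/-- `Ω` carries its Borel `σ`-algebra. -/
instance (p : ℝ) (m : ℕ) : MeasurableSpace (PathSpace p m) := borel (PathSpace p m)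

theorem isPath_shift {p : ℝ} {m : ℕ} {x : ℝ → EuclideanSpace ℝ (Fin m)} (hx : IsPath p x) (t : ℝ) :
    IsPath p (fun u => x (t + u) - x t) where
  continuous := by
    have := hx.continuous
    fun_prop
  map_zero := by simp
  pVar_lt_top a b hab := by
    rw [pVar_shift p (x := x) (r := t) (c := x t) (fun u => rfl)]
    exact hx.pVar_lt_top _ _ (by linarith)
  smooth_approx a b hab ε hε := by
    obtain ⟨φ, hφ, hlt⟩ := hx.smooth_approx (t + a) (t + b) (by linarith) ε hε
    refine ⟨fun u => φ (t + u) - x t, ?_, ?_⟩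
    · refine ContDiffOn.sub ?_ contDiffOn_const
      refine hφ.comp (by fun_prop) ?_
      intro u hu
      exact ⟨by linarith [hu.1], by linarith [hu.2]⟩
    · have h : ∀ u, ((fun u => x (t + u) - x t) - (fun u => φ (t + u) - x t)) u
          = (x - φ) (t + u) - 0 := fun u => by simp
      unfold pVarNorm at hlt ⊢
      rw [pVar_shift p h, h a, sub_zero]
      exact hlt

/-- The Wiener shift `(θ_t x)(u) = x (t + u) - x t` on `Ω`. -/
def shift {p : ℝ} {m : ℕ} (t : ℝ) (x : PathSpace p m) : PathSpace p m :=
  ⟨fun u => x (t + u) - x t, isPath_shift x.2 t⟩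

/-- `(Ω, 𝓕, P, θ)` is an ergodic metric dynamical system: every `θ_t` preserves `P`, and sets which
are invariant under all `θ_t` are trivial. -/
structure IsErgodicShift {p : ℝ} {m : ℕ} (P : Measure (PathSpace p m)) : Prop where
  measurePreserving : ∀ t : ℝ, MeasurePreserving (shift t) P P
  ergodic : ∀ B : Set (PathSpace p m), MeasurableSet B → (∀ t : ℝ, shift t ⁻¹' B = B) →
    P B = 0 ∨ P Bᶜ = 0

/-- `Γ(p) = (E ⦀Z⦀ᵖ_{p-var,[-1,1]})^{1/p}` for the canonical process `Z_t(x) = x t` under `P`. -/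
def Gam {p : ℝ} {m : ℕ} (P : Measure (PathSpace p m)) : ℝ≥0∞ :=
  (∫⁻ x, pVar p x (-1) 1 ^ p ∂P) ^ (1 / p)

/-! ### Coefficients and constants -/

/-- The coefficients of `dy = (A y + f y) dt + g(y) dx`, with the constants used to measure them.
The values of `g` are matrices in `ℝ^{d × m}`, seen as operators `ℝᵐ → ℝᵈ`. -/
structure Coeffs (d m : ℕ) where
  A : Matrix (Fin d) (Fin d) ℝ
  f : EuclideanSpace ℝ (Fin d) → EuclideanSpace ℝ (Fin d)
  g : EuclideanSpace ℝ (Fin d) → (EuclideanSpace ℝ (Fin m) →L[ℝ] EuclideanSpace ℝ (Fin d))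
  Cf : ℝ≥0
  Cg : ℝ≥0
  CA : ℝ
  lamA : ℝ

namespace Coeffs

variable {d m : ℕ} (S : Coeffs d m)

/-- `A` as an operator on Euclidean space. -/
def opA : EuclideanSpace ℝ (Fin d) →L[ℝ] EuclideanSpace ℝ (Fin d) :=
  Matrix.toEuclideanCLM (n := Fin d) (𝕜 := ℝ) S.A

/-- The operator norm `|A|`. -/
def normA : ℝ := ‖S.opA‖

/-- The semigroup `Φ(t) = e^{At}`. -/
def Phi (t : ℝ) : EuclideanSpace ℝ (Fin d) →L[ℝ] EuclideanSpace ℝ (Fin d) :=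
  NormedSpace.exp (t • S.opA)

/-- All (complex) eigenvalues of `A` have negative real part. -/
def Stable : Prop := ∀ z ∈ spectrum ℂ (S.A.map (algebraMap ℝ ℂ)), z.re < 0

/-- `f`, `g` are globally Lipschitz with constants `Cf`, `Cg`; `g` is `C¹` with globally Lipschitz
derivative. -/
structure Regular : Prop where
  f_lipschitz : LipschitzWith S.Cf S.f
  g_lipschitz : LipschitzWith S.Cg S.g
  g_contDiff : ContDiff ℝ 1 S.g
  Dg_lipschitz : ∃ C : ℝ≥0, LipschitzWith C (fderiv ℝ S.g)

/-- `C_A ≥ 1` and `λ_A > 0` satisfy `‖Φ‖_{∞,[a,b]} ≤ C_A e^{-λ_A a}` and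
`⦀Φ⦀_{p-var,[a,b]} ≤ |A| C_A e^{-λ_A a} (b - a)` for all `0 ≤ a < b`. -/
structure SemigroupBounds (p : ℝ) : Prop where
  one_le_CA : 1 ≤ S.CA
  lamA_pos : 0 < S.lamA
  sup_le : ∀ a b : ℝ, 0 ≤ a → a < b → ∀ t ∈ Icc a b, ‖S.Phi t‖ ≤ S.CA * Real.exp (-S.lamA * a)
  pVar_le : ∀ a b : ℝ, 0 ≤ a → a < b →
    pVar p S.Phi a b ≤ ENNReal.ofReal (S.normA * S.CA * Real.exp (-S.lamA * a) * (b - a))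

/-- `L = |A| + C_f`. -/
def L : ℝ := S.normA + S.Cf

/-- `λ = λ_A - C_A C_f`. -/
def lam : ℝ := S.lamA - S.CA * S.Cf

end Coeffs

/-- `K = (1 - 2^{1 - 2/p})⁻¹`. -/
def K (p : ℝ) : ℝ := (1 - (2 : ℝ) ^ (1 - 2 / p))⁻¹

/-- `α = log (1 + 1/(K+1))`. -/
def alpha (p : ℝ) : ℝ := Real.log (1 + 1 / (K p + 1))

namespace Coeffs

variable {d m : ℕ} (S : Coeffs d m) (p : ℝ)

/-- `M₁ = K C_A e^{λ_A} (1 + |A|)`. -/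
def M1 : ℝ := K p * S.CA * Real.exp S.lamA * (1 + S.normA)

/-- The factor `2 (K+1) C_g`. -/
def kap : ℝ := 2 * (K p + 1) * S.Cg

/-- The stability criterion
`λ_A - C_A C_f > C_A (1+|A|) e^{λ_A + 2(|A|+C_f)} ([2(K+1) C_g Γ]ᵖ + 2(K+1) C_g Γ)`. -/
def Criterion (Γ : ℝ) : Prop :=
  S.lamA - S.CA * S.Cf >
    S.CA * (1 + S.normA) * Real.exp (S.lamA + 2 * (S.normA + S.Cf)) *
      ((2 * (K p + 1) * S.Cg * Γ) ^ p + 2 * (K p + 1) * S.Cg * Γ)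

variable {p}

/-- The (finite) `p`-variation seminorm of `x ∈ Ω` on `[a,b]`, as a real number. -/
def _root_.YoungRDS.PathSpace.var (x : PathSpace p m) (a b : ℝ) : ℝ := (pVar p x a b).toReal

/-- `F(x,[a,b]) = exp (α (1 + [2(K+1)C_g]ᵖ ⦀x⦀ᵖ) + 2 L (b - a))`. -/
def F (x : PathSpace p m) (a b : ℝ) : ℝ :=
  Real.exp (alpha p * (1 + S.kap p ^ p * x.var a b ^ p) + 2 * S.L * (b - a))

/-- `Λ₁(x,[a,b]) = (1 + [2(K+1)C_g]^{p-1} ⦀x⦀^{p-1}) F(x,[a,b])`. -/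
def Lam1 (x : PathSpace p m) (a b : ℝ) : ℝ :=
  (1 + S.kap p ^ (p - 1) * x.var a b ^ (p - 1)) * S.F x a b

/-- `Λ₂(x,[a,b]) = 2^{(p-1)/p} (1 + [2(K+1)C_g]^{2p-1} ⦀x⦀^{2p-1}) F(x,[a,b])`. -/
def Lam2 (x : PathSpace p m) (a b : ℝ) : ℝ :=
  (2 : ℝ) ^ ((p - 1) / p) * (1 + S.kap p ^ (2 * p - 1) * x.var a b ^ (2 * p - 1)) * S.F x a b

/-- `G(x,[a,b]) = ⦀x⦀ Λ₁(x,[a,b])`. -/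
def G (x : PathSpace p m) (a b : ℝ) : ℝ := x.var a b * S.Lam1 x a b

/-- `H(x,[a,b]) = 1 + ⦀x⦀ (1 + Λ₂(x,[a,b]))`. -/
def H (x : PathSpace p m) (a b : ℝ) : ℝ := 1 + x.var a b * (1 + S.Lam2 x a b)

/-- The `k`-th term (`k ≥ 1`) of the series defining `b(x)`. -/
def bTerm (x : PathSpace p m) (ε : ℝ) (k : ℕ) : ℝ :=
  Real.exp (-S.lam * k) * S.H (shift (-(k : ℝ)) x) (-ε) (1 - ε) *
    ∏ j ∈ Finset.Icc 1 (k - 1), (1 + S.M1 p * S.Cg * S.G (shift (-(j : ℝ)) x) (-ε) (1 - ε))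

/-- `b(x)`, the supremum over `ε ∈ [0,1]` of the sum over `k ≥ 1` of the (nonnegative) terms
`bTerm`, with values in `[0,∞]`. -/
def b (x : PathSpace p m) : ℝ≥0∞ :=
  ⨆ ε ∈ Icc (0 : ℝ) 1, ∑' k : ℕ, ENNReal.ofReal (S.bTerm x ε (k + 1))

end Coeffs

/-- A positive `ρ` on `Ω`, with values in `[0,∞]`, is tempered if almost surely `ρ` is finite along
the orbit of `x` and `(1/t) log⁺ ρ(θ_t x) → 0` as `t → +∞` and as `t → -∞`. -/
def IsTempered {p : ℝ} {m : ℕ} (P : Measure (PathSpace p m)) (ρ : PathSpace p m → ℝ≥0∞) : Prop :=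
  (∀ x, 0 < ρ x) ∧
  ∀ᵐ x ∂P, (∀ t : ℝ, ρ (shift t x) < ∞) ∧
    Tendsto (fun t : ℝ => 1 / t * Real.posLog (ρ (shift t x)).toReal) atTop (𝓝 0) ∧
    Tendsto (fun t : ℝ => 1 / t * Real.posLog (ρ (shift t x)).toReal) atBot (𝓝 0)

end YoungRDS

end

/-! Write `v c` for the `p`-variation of `x` over `[c, c+1]`. Every factor in the series for `b`
lives on such a unit window. The constants are arranged so that the logarithm of a product factor is
at most `critConst * (kap ^ p * v ^ p + kap * v)` (`one_add_mul_G_le`), while `H` is at most `A *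
exp (B * v ^ p)` (`exists_H_le`).

For every `s` in `[c, c+1]` the window `[s-1, s+1]` contains `[c, c+1]`. Hence a nonnegative
combination of `v ^ p` and `v` is at most the increment over `[c, c+1]` of `J t = ∫₀ᵗ ψ (θ_s x) ds`,
where `ψ` is the same combination formed on `[-1, 1]` (`var_le_intervalIntegral`). This holds for
every real `c`, so the products telescope to increments of `J` simultaneously for all `ε` and all
shifts, and the supremum over `ε` costs nothing.

The criterion, with Jensen for the first moment, says that the mean of `ψ` is less than `λ`, with
room for a small extra multiple of `v ^ p` that dominates `H`. The ergodic theorem gives `J s = l *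
s + o(|s|)` with `l < λ`, and the series along the orbit is then bounded by a geometric one times
`exp (D * |t|)` with `D` arbitrarily small (`exists_b_shift_le`). Finiteness and temperedness both
follow.

The ergodic theorem itself comes from the maximal inequality: a cocycle of negative mean is almost
surely bounded above (`ae_bddAbove_cocycle`). It is applied to `J s - (l + δ) * s` and `(l - δ) * s
- J s`. -/

namespace YoungRDS

/-! ### The maximal ergodic inequality -/

/-- The maximum of the Birkhoff sums of `f` of length at most `n`. -/
noncomputable def maxBirkhoff {α : Type*} (T : α → α) (f : α → ℝ) : ℕ → α → ℝ
  | 0, _ => 0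
  | n + 1, x => max 0 (f x + maxBirkhoff T f n (T x))

section Maximal

variable {α : Type*} {T : α → α} {f : α → ℝ}

theorem maxBirkhoff_nonneg (n : ℕ) (x : α) : 0 ≤ maxBirkhoff T f n x := by
  cases n with
  | zero => exact le_rfl
  | succ n => exact le_max_left _ _

theorem maxBirkhoff_le_succ (n : ℕ) (x : α) :
    maxBirkhoff T f n x ≤ maxBirkhoff T f (n + 1) x := by
  induction n generalizing x with
  | zero => exact le_max_left _ _
  | succ n ih => exact max_le_max le_rfl (by linarith [ih (T x)])

theorem birkhoffSum_le_maxBirkhoff (n : ℕ) (x : α) :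
    birkhoffSum T f n x ≤ maxBirkhoff T f n x := by
  induction n generalizing x with
  | zero => simp [maxBirkhoff]
  | succ n ih =>
    rw [birkhoffSum_succ']
    exact le_max_of_le_right (by linarith [ih (T x)])

variable [MeasurableSpace α] {μ : Measure α}

theorem measurable_maxBirkhoff (hT : Measurable T) (hf : Measurable f) (n : ℕ) :
    Measurable (maxBirkhoff T f n) := by
  induction n with
  | zero => exact measurable_const
  | succ n ih => exact measurable_const.max (hf.add (ih.comp hT))

theorem integrable_maxBirkhoff (hT : MeasurePreserving T μ μ) (hf : Integrable f μ) (n : ℕ) :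
    Integrable (maxBirkhoff T f n) μ := by
  induction n with
  | zero => exact integrable_zero _ _ _
  | succ n ih =>
    exact (integrable_zero _ _ _).sup (hf.add (hT.integrable_comp_of_integrable ih))

/-- A consequence of the maximal ergodic inequality. -/
theorem integral_nonneg_of_ae_exists_birkhoffSum_pos (hT : MeasurePreserving T μ μ)
    (hfm : Measurable f) (hf : Integrable f μ) (h : ∀ᵐ x ∂μ, ∃ n, 0 < birkhoffSum T f n x) :
    0 ≤ ∫ x, f x ∂μ := by
  let E : ℕ → Set α := fun n => {x | 0 < maxBirkhoff T f (n + 1) x}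
  have hE : ∀ n, MeasurableSet (E n) := fun n =>
    measurableSet_lt measurable_const (measurable_maxBirkhoff hT.measurable hfm _)
  have hmono : Monotone E := monotone_nat_of_le_succ fun n x hx =>
    lt_of_lt_of_le (show 0 < maxBirkhoff T f (n + 1) x from hx) (maxBirkhoff_le_succ _ _)
  have hnonneg : ∀ n, 0 ≤ ∫ x in E n, f x ∂μ := fun n => by
    have hM := integrable_maxBirkhoff hT hf (n + 1)
    have hMT : Integrable (fun x => maxBirkhoff T f (n + 1) (T x)) μ :=
      hT.integrable_comp_of_integrable hM
    have h0 : ∫ x, (maxBirkhoff T f (n + 1) x - maxBirkhoff T f (n + 1) (T x)) ∂μ = 0 := by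
      rw [integral_sub hM hMT]
      have := hT.map_eq ▸ integral_map (μ := μ) hT.measurable.aemeasurable
        (f := maxBirkhoff T f (n + 1))
        (measurable_maxBirkhoff hT.measurable hfm _).aestronglyMeasurable
      linarith
    -- Garsia's argument: with `M` the maximal function, `M - M ∘ T` has integral zero and lies
    -- below `f` on `E n` and below `0` off `E n`.
    rw [← integral_indicator (hE n), ← h0]
    refine integral_mono (hM.sub hMT) (hf.indicator (hE n)) fun x => ?_
    by_cases hx : x ∈ E n
    · rw [indicator_of_mem hx]
      have h1 : maxBirkhoff T f (n + 1) x = f x + maxBirkhoff T f n (T x) := by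
        have h2 : 0 < max 0 (f x + maxBirkhoff T f n (T x)) := hx
        exact max_eq_right (by by_contra! h3; rw [max_eq_left h3.le] at h2; exact lt_irrefl _ h2)
      have := maxBirkhoff_le_succ (T := T) (f := f) n (T x)
      simp only
      linarith
    · rw [indicator_of_notMem hx]
      have h1 : maxBirkhoff T f (n + 1) x ≤ 0 := not_lt.1 hx
      have := maxBirkhoff_nonneg (T := T) (f := f) (n + 1) (T x)
      simp only
      linarith
  have hlim := tendsto_setIntegral_of_monotone hE hmono (f := f) (μ := μ) hf.integrableOn
  have huniv : (⋃ n, E n) =ᵐ[μ] univ := by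
    refine eventuallyEq_univ.2 ?_
    filter_upwards [h] with x ⟨n, hn⟩
    exact mem_iUnion.2 ⟨n, lt_of_lt_of_le hn
      ((birkhoffSum_le_maxBirkhoff n x).trans (maxBirkhoff_le_succ n x))⟩
  rw [setIntegral_congr_set huniv, setIntegral_univ] at hlim
  exact ge_of_tendsto' hlim hnonneg

end Maximal

/-! ### Ergodic flows -/

/-- An ergodic measure preserving action of `ℝ` (no joint measurability is required). -/
structure IsErgodicFlow {Ω : Type*} [MeasurableSpace Ω] (θ : ℝ → Ω → Ω) (μ : Measure Ω) :
    Prop where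
  zero : ∀ x, θ 0 x = x
  add : ∀ s t x, θ s (θ t x) = θ (s + t) x
  measurePreserving : ∀ t, MeasurePreserving (θ t) μ μ
  ergodic : ∀ B : Set Ω, MeasurableSet B → (∀ t : ℝ, θ t ⁻¹' B = B) → μ B = 0 ∨ μ Bᶜ = 0

namespace IsErgodicFlow

variable {Ω : Type*} [MeasurableSpace Ω] {θ : ℝ → Ω → Ω} {μ : Measure Ω}

/-- Transfers results for positive times to negative times. -/
theorem reverse (hθ : IsErgodicFlow θ μ) : IsErgodicFlow (fun t => θ (-t)) μ where
  zero x := by simp [hθ.zero]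
  add s t x := by rw [hθ.add]; congr 1; ring
  measurePreserving t := hθ.measurePreserving _
  ergodic B hB h := hθ.ergodic B hB fun t => by simpa using h (-t)

/-- An additive cocycle over an ergodic flow with negative mean, whose values at real times are
controlled by those at integer times, is almost surely bounded above. -/
theorem ae_bddAbove_cocycle (hθ : IsErgodicFlow θ μ) {h : Ω → ℝ → ℝ}
    (hco : ∀ x s t, h (θ t x) s = h x (s + t) - h x t)
    (hm : Measurable fun x => h x 1) (hi : Integrable (fun x => h x 1) μ)
    (hneg : ∫ x, h x 1 ∂μ < 0) (D : ℝ)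
    (hD : ∀ x T, 0 ≤ T → ∃ n : ℕ, h x T ≤ h x n + D) :
    ∀ᵐ x ∂μ, ∃ C, ∀ T, 0 ≤ T → h x T ≤ C := by
  have h0 : ∀ x, h x 0 = 0 := fun x => by simpa [hθ.zero] using hco x 0 0
  have hsum : ∀ n : ℕ, ∀ x, birkhoffSum (θ 1) (fun x => h x 1) n x = h x n := by
    intro n
    induction n with
    | zero => simp [h0]
    | succ n ih =>
      intro x
      rw [birkhoffSum_succ', ih, hco]
      push_cast
      ring
  have hmn : ∀ n : ℕ, Measurable fun x => h x n := fun n => by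
    simp_rw [← hsum n, birkhoffSum]
    exact Finset.measurable_fun_sum _ fun i _ =>
      hm.comp ((hθ.measurePreserving 1).measurable.iterate i)
  let B : Set Ω := {x | ∃ C : ℕ, ∀ n : ℕ, h x n ≤ C}
  have hB : MeasurableSet B := by
    have : B = ⋃ C : ℕ, ⋂ n : ℕ, {x | h x n ≤ C} := by ext x; simp [B]
    rw [this]
    exact MeasurableSet.iUnion fun C => MeasurableSet.iInter fun n =>
      measurableSet_le (hmn n) measurable_const
  -- Only the whole flow is ergodic, not necessarily its time-one map, so `B` must be invariant
  -- under real times although it only looks at integer ones; `hD` bridges the two. The finitely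
  -- many `n < N`, for which `n + t` may be negative, are bounded crudely.
  have hinv : ∀ t x, x ∈ B → θ t x ∈ B := by
    rintro t x ⟨C, hC⟩
    obtain ⟨N, hN⟩ := exists_nat_ge (-t)
    obtain ⟨C', hC'⟩ := exists_nat_ge
      (max (C + D - h x t) (∑ i ∈ Finset.range N, |h (θ t x) i|))
    refine ⟨C', fun n => le_trans ?_ hC'⟩
    by_cases hn : n < N
    · refine le_max_of_le_right ((le_abs_self _).trans ?_)
      exact Finset.single_le_sum (f := fun i : ℕ => |h (θ t x) i|) (fun i _ => abs_nonneg _)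
        (Finset.mem_range.2 hn)
    · refine le_max_of_le_left ?_
      have : (N : ℝ) ≤ n := by exact_mod_cast not_lt.1 hn
      obtain ⟨k, hk⟩ := hD x (n + t) (by linarith)
      rw [hco]
      linarith [hC k]
  have hinv' : ∀ t, θ t ⁻¹' B = B := fun t => by
    ext x
    refine ⟨fun hx => ?_, hinv t x⟩
    have := hinv (-t) _ hx
    rwa [hθ.add, neg_add_cancel, hθ.zero] at this
  -- If `B` were null, almost every orbit would have a positive Birkhoff sum, and the maximal
  -- inequality would contradict the negative mean.
  rcases hθ.ergodic B hB hinv' with h1 | h1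
  · refine absurd ?_ hneg.not_ge
    refine integral_nonneg_of_ae_exists_birkhoffSum_pos (hθ.measurePreserving 1) hm hi ?_
    filter_upwards [measure_eq_zero_iff_ae_notMem.1 h1] with x hx
    by_contra! hcon
    exact hx ⟨0, fun n => by simpa [hsum] using hcon n⟩
  · filter_upwards [measure_eq_zero_iff_ae_notMem.1 h1] with x hx
    obtain ⟨C, hC⟩ := not_not.1 hx
    refine ⟨C + D, fun T hT => ?_⟩
    obtain ⟨n, hn⟩ := hD x T hT
    linarith [hC n]

section Integral

variable {ψ : Ω → ℝ}

theorem intervalIntegral_cocycle (hθ : IsErgodicFlow θ μ)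
    (hloc : ∀ x a b, IntervalIntegrable (fun s => ψ (θ s x)) volume a b) (x : Ω) (s t : ℝ) :
    ∫ r in (0 : ℝ)..s, ψ (θ r (θ t x)) =
      (∫ r in (0 : ℝ)..(s + t), ψ (θ r x)) - ∫ r in (0 : ℝ)..t, ψ (θ r x) := by
  simp_rw [hθ.add]
  rw [intervalIntegral.integral_comp_add_right (fun r => ψ (θ r x)),
    intervalIntegral.integral_interval_sub_left (hloc _ _ _) (hloc _ _ _), zero_add]

variable [IsProbabilityMeasure μ]

/-- By invariance all time slices have the same `L¹` norm, so Tonelli applies on `(0, 1]`. -/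
theorem integrable_prod (hθ : IsErgodicFlow θ μ) (hψ : Integrable ψ μ)
    (hmeas : Measurable fun q : ℝ × Ω => ψ (θ q.1 q.2)) :
    Integrable (fun q : ℝ × Ω => ψ (θ q.1 q.2)) ((volume.restrict (Ioc 0 1)).prod μ) := by
  refine (integrable_prod_iff hmeas.aestronglyMeasurable).2 ⟨Eventually.of_forall fun s =>
    (hθ.measurePreserving s).integrable_comp_of_integrable hψ, ?_⟩
  have : ∀ s, ∫ x, ‖ψ (θ s x)‖ ∂μ = ∫ x, ‖ψ x‖ ∂μ := fun s => by
    conv_rhs => rw [← (hθ.measurePreserving s).map_eq]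
    rw [integral_map (hθ.measurePreserving s).measurable.aemeasurable]
    rw [(hθ.measurePreserving s).map_eq]
    exact hψ.norm.aestronglyMeasurable
  simp only [this]
  exact integrable_const _

theorem integral_intervalIntegral (hθ : IsErgodicFlow θ μ) (hψ : Integrable ψ μ)
    (hmeas : Measurable fun q : ℝ × Ω => ψ (θ q.1 q.2)) :
    ∫ x, (∫ s in (0 : ℝ)..1, ψ (θ s x)) ∂μ = ∫ x, ψ x ∂μ := by
  simp_rw [intervalIntegral.integral_of_le zero_le_one]
  rw [← integral_integral_swap (f := fun s x => ψ (θ s x)) (hθ.integrable_prod hψ hmeas)]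
  have : ∀ s, ∫ x, ψ (θ s x) ∂μ = ∫ x, ψ x ∂μ := fun s => by
    conv_rhs => rw [← (hθ.measurePreserving s).map_eq]
    rw [integral_map (hθ.measurePreserving s).measurable.aemeasurable]
    rw [(hθ.measurePreserving s).map_eq]
    exact hψ.aestronglyMeasurable
  simp [this]

theorem integrable_intervalIntegral (hθ : IsErgodicFlow θ μ) (hψ : Integrable ψ μ)
    (hmeas : Measurable fun q : ℝ × Ω => ψ (θ q.1 q.2)) :
    Integrable (fun x => ∫ s in (0 : ℝ)..1, ψ (θ s x)) μ := by
  simp_rw [intervalIntegral.integral_of_le zero_le_one]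
  exact (hθ.integrable_prod hψ hmeas).integral_prod_right

theorem measurable_intervalIntegral (hmeas : Measurable fun q : ℝ × Ω => ψ (θ q.1 q.2)) :
    Measurable fun x => ∫ s in (0 : ℝ)..1, ψ (θ s x) := by
  simp_rw [intervalIntegral.integral_of_le zero_le_one]
  exact hmeas.stronglyMeasurable.integral_prod_left.measurable

/-- Integrals of a nonnegative function along an ergodic flow, in positive time. -/
theorem ae_intervalIntegral_bounds (hθ : IsErgodicFlow θ μ) (hψ0 : ∀ x, 0 ≤ ψ x)
    (hψ : Integrable ψ μ) (hmeas : Measurable fun q : ℝ × Ω => ψ (θ q.1 q.2))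
    (hloc : ∀ x a b, IntervalIntegrable (fun s => ψ (θ s x)) volume a b) {δ : ℝ} (hδ : 0 < δ) :
    ∀ᵐ x ∂μ, ∃ C, ∀ s, 0 ≤ s →
      |(∫ r in (0 : ℝ)..s, ψ (θ r x)) - (∫ y, ψ y ∂μ) * s| ≤ δ * s + C := by
  set l := ∫ y, ψ y ∂μ
  have hl : 0 ≤ l := integral_nonneg hψ0
  have hmono : ∀ x s t, s ≤ t →
      ∫ r in (0 : ℝ)..s, ψ (θ r x) ≤ ∫ r in (0 : ℝ)..t, ψ (θ r x) := fun x s t hst => by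
    rw [← sub_nonneg, intervalIntegral.integral_interval_sub_left (hloc _ _ _) (hloc _ _ _)]
    exact intervalIntegral.integral_nonneg hst fun _ _ => hψ0 _
  have hint := hθ.integrable_intervalIntegral hψ hmeas
  have hupper := hθ.ae_bddAbove_cocycle
    (h := fun x s => (∫ r in (0 : ℝ)..s, ψ (θ r x)) - (l + δ) * s)
    (fun x s t => by
      rw [hθ.intervalIntegral_cocycle hloc]
      ring)
    ((measurable_intervalIntegral hmeas).sub_const _) (hint.sub (integrable_const _))
    (by
      rw [integral_sub hint (integrable_const _), hθ.integral_intervalIntegral hψ hmeas]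
      simpa [l] using hδ) (l + δ)
    (fun x s hs => ⟨⌈s⌉₊, by
      have h1 := hmono x s ⌈s⌉₊ (Nat.le_ceil s)
      have h2 := Nat.ceil_lt_add_one hs
      have h3 : (l + δ) * ⌈s⌉₊ ≤ (l + δ) * (s + 1) :=
        mul_le_mul_of_nonneg_left h2.le (by positivity)
      linarith⟩)
  have hlower := hθ.ae_bddAbove_cocycle
    (h := fun x s => (l - δ) * s - ∫ r in (0 : ℝ)..s, ψ (θ r x))
    (fun x s t => by
      rw [hθ.intervalIntegral_cocycle hloc]
      ring)
    ((measurable_intervalIntegral hmeas).const_sub _) ((integrable_const _).sub hint)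
    (by
      rw [integral_sub (integrable_const _) hint, hθ.integral_intervalIntegral hψ hmeas]
      simpa [l] using hδ) |l - δ|
    -- Monotonicity of the integral lets the floor replace `s` at bounded cost; `l - δ` may be
    -- negative, hence the absolute value in the constant.
    (fun x s hs => ⟨⌊s⌋₊, by
      have h1 := hmono x ⌊s⌋₊ s (Nat.floor_le hs)
      have h2 := (Nat.lt_floor_add_one s).le
      have h3 : (l - δ) * (s - ⌊s⌋₊) ≤ |l - δ| * 1 :=
        mul_le_mul (le_abs_self _) (by linarith) (by linarith [Nat.floor_le hs]) (abs_nonneg _)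
      linarith⟩)
  filter_upwards [hupper, hlower] with x ⟨C₁, h₁⟩ ⟨C₂, h₂⟩
  refine ⟨max C₁ C₂, fun s hs => abs_le.2 ⟨?_, ?_⟩⟩
  · linarith [h₂ s hs, le_max_right C₁ C₂]
  · linarith [h₁ s hs, le_max_left C₁ C₂]

/-- Pointwise ergodic theorem for a nonnegative function along an ergodic flow, in both time
directions. -/
theorem ae_forall_intervalIntegral_bounds (hθ : IsErgodicFlow θ μ) (hψ0 : ∀ x, 0 ≤ ψ x)
    (hψ : Integrable ψ μ) (hmeas : Measurable fun q : ℝ × Ω => ψ (θ q.1 q.2))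
    (hloc : ∀ x a b, IntervalIntegrable (fun s => ψ (θ s x)) volume a b) :
    ∀ᵐ x ∂μ, ∀ δ : ℝ, 0 < δ → ∃ C, ∀ s,
      |(∫ r in (0 : ℝ)..s, ψ (θ r x)) - (∫ y, ψ y ∂μ) * s| ≤ δ * |s| + C := by
  have hmeas' : Measurable fun q : ℝ × Ω => ψ (θ (-q.1) q.2) :=
    hmeas.comp (measurable_fst.neg.prodMk measurable_snd)
  have hloc' : ∀ x a b, IntervalIntegrable (fun s => ψ (θ (-s) x)) volume a b := fun x a b => by
    simpa using ((IntervalIntegrable.iff_comp_neg enorm_ne_top).1 (hloc x (-a) (-b)))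
  -- Countably many `δ` suffice, so the exceptional null set can be chosen independent of `δ`.
  have key : ∀ n : ℕ, ∀ᵐ x ∂μ, ∃ C, ∀ s,
      |(∫ r in (0 : ℝ)..s, ψ (θ r x)) - (∫ y, ψ y ∂μ) * s| ≤ 1 / (n + 1 : ℝ) * |s| + C := by
    intro n
    have hn : (0 : ℝ) < 1 / (n + 1) := by positivity
    filter_upwards [hθ.ae_intervalIntegral_bounds hψ0 hψ hmeas hloc hn,
      hθ.reverse.ae_intervalIntegral_bounds hψ0 hψ hmeas' hloc' hn] with x ⟨C₁, h₁⟩ ⟨C₂, h₂⟩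
    refine ⟨max C₁ C₂, fun s => ?_⟩
    rcases le_total 0 s with hs | hs
    · rw [abs_of_nonneg hs]
      exact (h₁ s hs).trans (by gcongr; exact le_max_left _ _)
    · have := h₂ (-s) (by linarith)
      rw [intervalIntegral.integral_comp_neg (fun r => ψ (θ r x)), neg_neg, neg_zero,
        intervalIntegral.integral_symm, mul_neg, ← neg_sub', abs_neg] at this
      rw [abs_of_nonpos hs]
      exact this.trans (by gcongr; exact le_max_right _ _)
  filter_upwards [ae_all_iff.2 key] with x hx δ hδ
  obtain ⟨n, hn⟩ := exists_nat_one_div_lt hδ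
  obtain ⟨C, hC⟩ := hx n
  exact ⟨C, fun s => (hC s).trans (by gcongr)⟩

end Integral

end IsErgodicFlow

/-! ### Properties of the `p`-variation -/

section PVar

variable {E : Type*} {p : ℝ}

theorem pVarPow_mono [PseudoEMetricSpace E] (x : ℝ → E) {a b a' b' : ℝ} (ha : a' ≤ a)
    (hb : b ≤ b') : pVarPow p x a b ≤ pVarPow p x a' b' :=
  iSup_le fun q => le_iSup_of_le
    ⟨q.1, q.2.1, q.2.2.1, fun i => ⟨ha.trans (q.2.2.2 i).1, (q.2.2.2 i).2.trans hb⟩⟩ le_rfl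

theorem pVar_mono [PseudoEMetricSpace E] (hp : 0 ≤ p) (x : ℝ → E) {a b a' b' : ℝ} (ha : a' ≤ a)
    (hb : b ≤ b') : pVar p x a b ≤ pVar p x a' b' :=
  ENNReal.rpow_le_rpow (pVarPow_mono x ha hb) (by positivity)

theorem pVar_rpow [PseudoEMetricSpace E] (hp : 0 < p) (x : ℝ → E) (a b : ℝ) :
    pVar p x a b ^ p = pVarPow p x a b := by
  rw [pVar, ← ENNReal.rpow_mul, one_div_mul_cancel hp.ne', ENNReal.rpow_one]

/-- Minkowski's inequality in `ℓᵖ`, applied to each partition sum. -/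
theorem pVar_le_add [PseudoEMetricSpace E] (hp : 1 ≤ p) {E' E'' : Type*} [PseudoEMetricSpace E']
    [PseudoEMetricSpace E''] {x : ℝ → E} {y : ℝ → E'} {z : ℝ → E''}
    (h : ∀ s t, edist (x s) (x t) ≤ edist (y s) (y t) + edist (z s) (z t)) (a b : ℝ) :
    pVar p x a b ≤ pVar p y a b + pVar p z a b := by
  have hp0 : 0 < p := by linarith
  rw [pVar, one_div, ENNReal.rpow_inv_le_iff hp0]
  refine iSup_le fun q => ?_
  rw [← ENNReal.rpow_inv_le_iff hp0, ← one_div]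
  calc _ ≤ (∑ i ∈ Finset.range q.1, (edist (y (q.2.1 (i + 1))) (y (q.2.1 i)) +
          edist (z (q.2.1 (i + 1))) (z (q.2.1 i))) ^ p) ^ (1 / p) := by
        gcongr
        exact h _ _
    _ ≤ _ := ENNReal.Lp_add_le _ _ _ hp
    _ ≤ _ := by
        unfold pVar
        gcongr
        · exact le_iSup_of_le q le_rfl
        · exact le_iSup_of_le q le_rfl

/-- The `p`-variation of a continuous path over `[a,b]` is exhausted by inner rational intervals. -/
theorem exists_rat_lt_pVarPow [PseudoEMetricSpace E] {x : ℝ → E} (hx : Continuous x)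
    {a b : ℝ} (hab : a < b) {c : ℝ≥0∞} (hc : c < pVarPow p x a b) :
    ∃ a' b' : ℚ, a < a' ∧ (b' : ℝ) < b ∧ c < pVarPow p x a' b' := by
  obtain ⟨⟨n, t, htm, htI⟩, hq⟩ := lt_iSup_iff.1 hc
  simp only at hq
  -- Contract a good partition towards the midpoint by the factor `1 - η`. Its sum depends
  -- continuously on `η`, so it stays above `c` for small `η > 0`, and the contraction leaves room
  -- for rational end points.
  set m := (a + b) / 2 with hm
  have hcont : Continuous fun η : ℝ => ∑ i ∈ Finset.range n,
      edist (x (m + (1 - η) * (t (i + 1) - m))) (x (m + (1 - η) * (t i - m))) ^ p :=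
    continuous_finsetSum _ fun i _ =>
      ENNReal.continuous_rpow_const.comp ((hx.comp (by fun_prop)).edist (hx.comp (by fun_prop)))
  have h0 : ∀ᶠ η in 𝓝[>] (0 : ℝ), c < ∑ i ∈ Finset.range n,
      edist (x (m + (1 - η) * (t (i + 1) - m))) (x (m + (1 - η) * (t i - m))) ^ p :=
    nhdsWithin_le_nhds ((hcont.tendsto 0).eventually_const_lt (by simpa using hq))
  obtain ⟨η, hη, hη0, hη1⟩ := (h0.and (Ioo_mem_nhdsGT zero_lt_one)).exists
  have hbm : 0 < η * (b - m) := mul_pos hη0 (by linarith)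
  obtain ⟨a', ha1, ha2⟩ := exists_rat_btwn (show a < m + (1 - η) * (a - m) by nlinarith)
  obtain ⟨b', hb1, hb2⟩ := exists_rat_btwn (show m + (1 - η) * (b - m) < b by nlinarith)
  refine ⟨a', b', ha1, hb2, hη.trans_le ?_⟩
  refine le_iSup_of_le ⟨n, fun i => m + (1 - η) * (t i - m), fun i j hij => ?_, fun i => ⟨?_, ?_⟩⟩
    le_rfl
  · have := htm hij
    simp only
    gcongr
  · refine ha2.le.trans ?_
    exact add_le_add_right (mul_le_mul_of_nonneg_left (sub_le_sub_right (htI i).1 m)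
      (by linarith)) m
  · refine le_trans ?_ hb1.le
    exact add_le_add_right (mul_le_mul_of_nonneg_left (sub_le_sub_right (htI i).2 m)
      (by linarith)) m

end PVar

/-! ### The path space -/

section PathSpace

variable {p : ℝ} {m : ℕ}

instance : OpensMeasurableSpace (PathSpace p m) := ⟨le_rfl⟩

theorem shift_zero (x : PathSpace p m) : shift 0 x = x :=
  Subtype.ext <| funext fun u => by simp [shift, x.2.map_zero]

theorem shift_shift (s t : ℝ) (x : PathSpace p m) : shift s (shift t x) = shift (s + t) x :=
  Subtype.ext <| funext fun u => by
    simp only [shift, sub_sub_sub_cancel_right]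
    congr 2 <;> ring_nf

theorem pVar_shift_apply (x : PathSpace p m) (t a b : ℝ) :
    pVar p (shift t x) a b = pVar p x (t + a) (t + b) :=
  pVar_shift p (fun _ => rfl) a b

theorem var_shift (x : PathSpace p m) (t a b : ℝ) :
    (shift t x).var a b = x.var (t + a) (t + b) := by
  rw [PathSpace.var, PathSpace.var, pVar_shift_apply]

theorem var_nonneg (x : PathSpace p m) (a b : ℝ) : 0 ≤ x.var a b := ENNReal.toReal_nonneg

theorem var_mono (hp : 0 ≤ p) (x : PathSpace p m) {a b a' b' : ℝ} (ha : a' ≤ a) (hb : b ≤ b')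
    (hab : a ≤ b) : x.var a b ≤ x.var a' b' :=
  ENNReal.toReal_mono (x.2.pVar_lt_top _ _ (ha.trans (hab.trans hb))).ne (pVar_mono hp x ha hb)

theorem pathDist_self (hp : 0 < p) (x : PathSpace p m) : pathDist x x = 0 := by
  have : ∀ k : ℝ, pVarNorm p (fun u => x u - x u) (-(k + 1)) (k + 1) = 0 := fun k => by
    simp [pVarNorm, pVar, pVarPow, hp]
  simp only [pathDist, this]
  simp

/-- Only balls centred at `x` itself are used, so no triangle inequality for `pathDist` is needed.
-/
theorem tendsto_pathDist (hp : 0 < p) (x : PathSpace p m) : Tendsto (pathDist x) (𝓝 x) (𝓝 0) := by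
  refine ENNReal.tendsto_nhds_zero.2 fun ε hε => ?_
  have hopen : IsOpen {y | pathDist x y < ε} :=
    TopologicalSpace.isOpen_generateFrom_of_mem ⟨x, ε, rfl⟩
  filter_upwards [hopen.mem_nhds (by simpa [pathDist_self hp] using hε)] with y hy
  exact le_of_lt hy

theorem tendsto_pVar_sub (hp : 0 < p) (x : PathSpace p m) (a b : ℝ) :
    Tendsto (fun y : PathSpace p m => pVar p (fun u => x u - y u) a b) (𝓝 x) (𝓝 0) := by
  refine ENNReal.tendsto_nhds_zero.2 fun ε hε => ?_
  obtain ⟨k, hk⟩ := exists_nat_ge (max (-a) b)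
  have hk1 := (le_max_left _ _).trans hk
  have hk2 := (le_max_right _ _).trans hk
  have hpos : 0 < (2⁻¹ : ℝ≥0∞) ^ (k + 1) * min ε 1 :=
    ENNReal.mul_pos (by simp) (lt_min hε one_pos).ne'
  filter_upwards [(tendsto_pathDist hp x).eventually_lt_const hpos] with y hy
  have h1 := (ENNReal.le_tsum (f := fun k : ℕ => (2⁻¹ : ℝ≥0∞) ^ (k + 1) *
    min (pVarNorm p (fun u => x u - y u) (-((k : ℝ) + 1)) ((k : ℝ) + 1)) 1) k).trans_lt hy
  have h2 := lt_of_mul_lt_mul_left' h1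
  have h3 : pVarNorm p (fun u => x u - y u) (-((k : ℝ) + 1)) ((k : ℝ) + 1) < ε := by
    -- The radius was chosen below `1`, so the truncation in the metric is inactive.
    rcases min_lt_iff.1 h2 with h | h
    · exact h.trans_le (min_le_left _ _)
    · exact absurd h (min_le_right _ _).not_gt
  exact ((pVar_mono hp.le _ (by linarith) (by linarith)).trans le_add_self).trans h3.le

/-- The reverse triangle inequality squeezes the seminorm of `y` between that of `x` plus or minus
that of `x - y`. For `b < a` there are no partitions and the value is `0`. -/
theorem continuous_pVar (hp : 1 ≤ p) (a b : ℝ) :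
    Continuous fun x : PathSpace p m => pVar p x a b := by
  refine continuous_iff_continuousAt.2 fun x => ?_
  have hlim := tendsto_pVar_sub (by linarith) x a b
  rcases lt_or_ge b a with hba | hab
  · have : ∀ x : PathSpace p m, pVar p x a b = 0 := fun x => by
      have : IsEmpty (ℕ × {t : ℕ → ℝ // Monotone t ∧ ∀ i, t i ∈ Icc a b}) :=
        ⟨fun q => by linarith [(q.2.2.2 0).1, (q.2.2.2 0).2]⟩
      rw [pVar, pVarPow, iSup_of_empty, bot_eq_zero, ENNReal.zero_rpow_of_pos (by positivity)]
    simp only [this]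
    exact tendsto_const_nhds
  have hfin := (x.2.pVar_lt_top a b hab).ne
  have hsub : ∀ (x y : PathSpace p m) (s t : ℝ), edist (x s) (x t) ≤
      edist (y s) (y t) + edist (x s - y s) (x t - y t) := fun x y s t => by
    rw [edist_eq_enorm_sub, edist_eq_enorm_sub, edist_eq_enorm_sub]
    refine le_trans (le_of_eq ?_) (enorm_add_le _ _)
    congr 1
    abel
  refine tendsto_of_tendsto_of_tendsto_of_le_of_le
    (g := fun y => pVar p x a b - pVar p (fun u => x u - y u) a b)
    (h := fun y => pVar p x a b + pVar p (fun u => x u - y u) a b) ?_ ?_ (fun y => ?_) fun y => ?_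
  · simpa using ENNReal.Tendsto.sub tendsto_const_nhds hlim (Or.inl hfin)
  · simpa using tendsto_const_nhds.add hlim
  · exact tsub_le_iff_right.2 (pVar_le_add hp (hsub x y) a b)
  · refine pVar_le_add hp (fun s t => ?_) a b
    refine (hsub y x s t).trans (le_of_eq ?_)
    congr 1
    rw [edist_eq_enorm_sub, edist_eq_enorm_sub, ← enorm_neg]
    congr 1
    abel

theorem continuous_var (hp : 1 ≤ p) {a b : ℝ} (hab : a ≤ b) :
    Continuous fun x : PathSpace p m => x.var a b :=
  ENNReal.continuousOn_toReal.comp_continuous (continuous_pVar hp a b)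
    fun x => (x.2.pVar_lt_top a b hab).ne

/-- Joint measurability in time and path of the `p`-variation over a moving window. -/
theorem measurable_pVar_shift (hp : 1 ≤ p) :
    Measurable fun q : ℝ × PathSpace p m => pVar p (shift q.1 q.2) (-1) 1 := by
  have hp0 : 0 < p := by linarith
  simp only [pVar_shift_apply]
  refine Measurable.pow_const (measurable_of_Ioi fun c => ?_) _
  -- Rational exhaustion turns the superlevel set into a countable union of measurable rectangles.
  have : (fun q : ℝ × PathSpace p m => pVarPow p q.2 (q.1 + -1) (q.1 + 1)) ⁻¹' Ioi c =
      ⋃ (a : ℚ) (b : ℚ), {s : ℝ | s + -1 < a ∧ (b : ℝ) < s + 1} ×ˢ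
        {x : PathSpace p m | c < pVarPow p x a b} := by
    ext ⟨s, x⟩
    simp only [mem_preimage, mem_Ioi, mem_iUnion, mem_prod, mem_ofPred_eq]
    constructor
    · intro h
      obtain ⟨a, b, h1, h2, h3⟩ := exists_rat_lt_pVarPow x.2.continuous (by linarith) h
      exact ⟨a, b, ⟨h1, h2⟩, h3⟩
    · rintro ⟨a, b, ⟨h1, h2⟩, h3⟩
      exact h3.trans_le (pVarPow_mono x h1.le h2.le)
  rw [this]
  refine MeasurableSet.iUnion fun a => MeasurableSet.iUnion fun b => MeasurableSet.prod ?_ ?_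
  · exact (measurableSet_lt (measurable_id.add_const _) measurable_const).inter
      (measurableSet_lt measurable_const (measurable_id.add_const _))
  · simp_rw [← pVar_rpow hp0]
    exact measurableSet_lt measurable_const
      ((continuous_pVar hp _ _).measurable.pow_const _)

theorem measurable_var_shift (hp : 1 ≤ p) :
    Measurable fun q : ℝ × PathSpace p m => (shift q.1 q.2).var (-1) 1 :=
  (measurable_pVar_shift hp).ennreal_toReal

theorem IsErgodicShift.isErgodicFlow {P : Measure (PathSpace p m)} (hP : IsErgodicShift P) :
    IsErgodicFlow (shift (p := p) (m := m)) P where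
  zero := shift_zero
  add := shift_shift
  measurePreserving := hP.measurePreserving
  ergodic := hP.ergodic

/-! ### Moments of the `p`-variation -/

theorem lintegral_pVar_rpow {P : Measure (PathSpace p m)} (hp : 0 < p) :
    ∫⁻ x, pVar p x (-1) 1 ^ p ∂P = Gam P ^ p := by
  rw [Gam, ← ENNReal.rpow_mul, one_div_mul_cancel hp.ne', ENNReal.rpow_one]

/-- Hölder against the constant `1` on a probability space. -/
theorem lintegral_pVar_le {P : Measure (PathSpace p m)} [IsProbabilityMeasure P] (hp : 1 < p) :
    ∫⁻ x, pVar p x (-1) 1 ∂P ≤ Gam P := by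
  have hpq := Real.HolderConjugate.conjExponent hp
  have h := ENNReal.lintegral_mul_le_Lp_mul_Lq P hpq
    (continuous_pVar (m := m) hp.le (-1) 1).measurable.aemeasurable
    (aemeasurable_const (b := (1 : ℝ≥0∞)))
  simpa [Gam] using h

theorem integrable_var {P : Measure (PathSpace p m)} [IsProbabilityMeasure P] (hp : 1 < p)
    (hG : Gam P < ∞) : Integrable (fun x : PathSpace p m => x.var (-1) 1) P :=
  integrable_toReal_of_lintegral_ne_top
    (continuous_pVar hp.le (-1) 1).measurable.aemeasurable
    ((lintegral_pVar_le hp).trans_lt hG).ne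

theorem integral_var_le {P : Measure (PathSpace p m)} [IsProbabilityMeasure P] (hp : 1 < p)
    (hG : Gam P < ∞) : ∫ x : PathSpace p m, x.var (-1) 1 ∂P ≤ (Gam P).toReal := by
  simp only [PathSpace.var]
  rw [integral_toReal (continuous_pVar hp.le (-1) 1).measurable.aemeasurable
    (Eventually.of_forall fun x => x.2.pVar_lt_top _ _ (by norm_num))]
  exact ENNReal.toReal_mono hG.ne (lintegral_pVar_le hp)

theorem var_rpow (x : PathSpace p m) (a b : ℝ) :
    x.var a b ^ p = (pVar p x a b ^ p).toReal := (ENNReal.toReal_rpow _ _).symm ▸ rfl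

theorem integrable_var_rpow {P : Measure (PathSpace p m)} (hp : 1 < p)
    (hG : Gam P < ∞) : Integrable (fun x : PathSpace p m => x.var (-1) 1 ^ p) P := by
  simp only [var_rpow]
  refine integrable_toReal_of_lintegral_ne_top
    ((continuous_pVar hp.le (-1) 1).measurable.pow_const _).aemeasurable ?_
  rw [lintegral_pVar_rpow (by linarith)]
  exact ENNReal.rpow_ne_top_of_nonneg (by linarith) hG.ne

theorem integral_var_rpow {P : Measure (PathSpace p m)} (hp : 1 < p) :
    ∫ x : PathSpace p m, x.var (-1) 1 ^ p ∂P = (Gam P).toReal ^ p := by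
  simp only [var_rpow]
  rw [integral_toReal ((continuous_pVar hp.le (-1) 1).measurable.pow_const _).aemeasurable
    (Eventually.of_forall fun x => ENNReal.rpow_lt_top_of_nonneg (by linarith)
      (x.2.pVar_lt_top _ _ (by norm_num)).ne), lintegral_pVar_rpow (by linarith),
    ENNReal.toReal_rpow]

end PathSpace

/-! ### The constants -/

section Constants

variable {p : ℝ}

theorem one_le_K (hp : p ∈ Ioo (1 : ℝ) 2) : 1 ≤ K p := by
  have hp0 : 0 < p := by linarith [hp.1]
  have h1 : (2 : ℝ) ^ (1 - 2 / p) < 1 := by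
    refine Real.rpow_lt_one_of_one_lt_of_neg one_lt_two ?_
    rw [sub_neg, one_lt_div hp0]
    exact hp.2
  have h2 : (0 : ℝ) < 2 ^ (1 - 2 / p) := by positivity
  exact (one_le_inv₀ (by linarith)).2 (by linarith)

theorem exp_alpha (hp : p ∈ Ioo (1 : ℝ) 2) : Real.exp (alpha p) = 1 + 1 / (K p + 1) := by
  have := one_le_K hp
  exact Real.exp_log (by positivity)

theorem alpha_nonneg (hp : p ∈ Ioo (1 : ℝ) 2) : 0 ≤ alpha p := by
  have := one_le_K hp
  exact Real.log_nonneg (le_add_of_nonneg_right (by positivity))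

/-- From `log (1 + z) ≤ z` and `1 ≤ K p`. The value `1 / 2` is what `one_add_mul_G_le` can absorb,
because `1 ≤ critConst`. -/
theorem alpha_le (hp : p ∈ Ioo (1 : ℝ) 2) : alpha p ≤ 1 / 2 := by
  have h := one_le_K hp
  have h1 : alpha p ≤ 1 + 1 / (K p + 1) - 1 := Real.log_le_sub_one_of_pos (by positivity)
  have h2 : 1 / (K p + 1) ≤ 1 / 2 := one_div_le_one_div_of_le (by norm_num) (by linarith)
  linarith

end Constants

/-! ### Pointwise bounds for the factors of `b` on unit windows. -/

namespace Coeffs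

variable {d m : ℕ} {p : ℝ} (S : Coeffs d m)

/-- The constant `C_A (1 + |A|) e^{λ_A + 2 L}` of the stability criterion. -/
noncomputable def critConst : ℝ :=
  S.CA * (1 + S.normA) * Real.exp (S.lamA + 2 * (S.normA + S.Cf))

variable {S}

theorem normA_nonneg : 0 ≤ S.normA := norm_nonneg _

theorem kap_nonneg (hp : p ∈ Ioo (1 : ℝ) 2) : 0 ≤ S.kap p := by
  have := one_le_K hp
  have := S.Cg.2
  unfold kap
  positivity

theorem one_le_critConst (hS : S.SemigroupBounds p) : 1 ≤ S.critConst := by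
  have h1 := hS.one_le_CA
  have h2 := S.normA_nonneg
  have h3 : 1 ≤ Real.exp (S.lamA + 2 * (S.normA + S.Cf)) :=
    Real.one_le_exp (by have := hS.lamA_pos; have := S.Cf.2; positivity)
  exact one_le_mul_of_one_le_of_one_le (one_le_mul_of_one_le_of_one_le h1 (by linarith)) h3

theorem F_eq (x : PathSpace p m) (a b : ℝ) (hab : b - a = 1) :
    S.F x a b = Real.exp (alpha p) * Real.exp (alpha p * (S.kap p ^ p * x.var a b ^ p)) *
      Real.exp (2 * S.L) := by
  rw [F, hab, ← Real.exp_add, ← Real.exp_add]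
  ring_nf

theorem F_nonneg (x : PathSpace p m) (a b : ℝ) : 0 ≤ S.F x a b := (Real.exp_pos _).le

theorem Lam1_nonneg (hp : p ∈ Ioo (1 : ℝ) 2) (x : PathSpace p m) (a b : ℝ) :
    0 ≤ S.Lam1 x a b := by
  have := S.F_nonneg x a b
  have := S.kap_nonneg hp
  have := var_nonneg x a b
  unfold Lam1
  positivity

theorem Lam2_nonneg (hp : p ∈ Ioo (1 : ℝ) 2) (x : PathSpace p m) (a b : ℝ) :
    0 ≤ S.Lam2 x a b := by
  have := S.F_nonneg x a b
  have := S.kap_nonneg hp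
  have := var_nonneg x a b
  unfold Lam2
  positivity

theorem G_nonneg (hp : p ∈ Ioo (1 : ℝ) 2) (x : PathSpace p m) (a b : ℝ) : 0 ≤ S.G x a b :=
  mul_nonneg (var_nonneg x a b) (Lam1_nonneg hp x a b)

theorem one_le_H (hp : p ∈ Ioo (1 : ℝ) 2) (x : PathSpace p m) (a b : ℝ) : 1 ≤ S.H x a b := by
  have := S.Lam2_nonneg hp x a b
  have := var_nonneg x a b
  exact le_add_of_nonneg_right (by positivity)

theorem M1_mul_Cg_nonneg (hp : p ∈ Ioo (1 : ℝ) 2) (hS : S.SemigroupBounds p) :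
    0 ≤ S.M1 p * S.Cg := by
  have h1 := hS.one_le_CA
  have h2 := S.normA_nonneg
  have h3 := S.Cg.2
  have h4 := one_le_K hp
  unfold M1
  positivity

/-- The logarithm of a factor of the product in `b` is dominated by the stability criterion. -/
theorem one_add_mul_G_le (hp : p ∈ Ioo (1 : ℝ) 2) (hS : S.SemigroupBounds p)
    (x : PathSpace p m) (a b : ℝ) (hab : b - a = 1) :
    1 + S.M1 p * S.Cg * S.G x a b ≤
      Real.exp (S.critConst * (S.kap p ^ p * x.var a b ^ p + S.kap p * x.var a b)) := by
  have hC := one_le_critConst hS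
  have hK := one_le_K hp
  have hv := var_nonneg x a b
  have hk := S.kap_nonneg hp
  have hp0 : 0 < p := by linarith [hp.1]
  rw [← Real.mul_rpow hk hv]
  set u := S.kap p * x.var a b with hu
  have hu0 : 0 ≤ u := mul_nonneg hk hv
  have hup : 0 ≤ u ^ p := by positivity
  have hupow : u * u ^ (p - 1) = u ^ p := by
    rw [mul_comm, ← Real.rpow_add_one' hu0 (by linarith), sub_add_cancel]
  have heq : S.M1 p * S.Cg * S.G x a b = S.critConst *
      (K p / (2 * (K p + 1)) * (1 + 1 / (K p + 1))) * (u + u ^ p) *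
        Real.exp (alpha p * u ^ p) := by
    rw [G, Lam1, F_eq x a b hab, exp_alpha hp, ← Real.mul_rpow hk hv, ← Real.mul_rpow hk hv, ← hu,
      ← hupow, critConst, M1, L, Real.exp_add]
    have : S.Cg * x.var a b = u / (2 * (K p + 1)) := by
      rw [hu, kap]
      field_simp
    calc _ = K p * S.CA * Real.exp S.lamA * (1 + S.normA) * (S.Cg * x.var a b) *
        ((1 + u ^ (p - 1)) * ((1 + 1 / (K p + 1)) * Real.exp (alpha p * (u * u ^ (p - 1))) *
          Real.exp (2 * (S.normA + S.Cf)))) := by ring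
      _ = _ := by rw [this]; ring
  -- This is `K (K + 2) ≤ (K + 1)²`. It spends only half of `critConst` on the prefactor; the other
  -- half pays for the exponent `alpha p * u ^ p`.
  have hfrac : K p / (2 * (K p + 1)) * (1 + 1 / (K p + 1)) ≤ 1 / 2 := by
    have : K p / (2 * (K p + 1)) * (1 + 1 / (K p + 1)) =
        (K p * (K p + 2)) / (2 * (K p + 1) ^ 2) := by
      field_simp
      ring
    rw [this, div_le_div_iff₀ (by positivity) two_pos]
    nlinarith
  have h1 : S.M1 p * S.Cg * S.G x a b ≤
      S.critConst * (1 / 2) * (u + u ^ p) * Real.exp (alpha p * u ^ p) := by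
    rw [heq]
    gcongr
  have h2 : 1 ≤ Real.exp (alpha p * u ^ p) :=
    Real.one_le_exp (mul_nonneg (alpha_nonneg hp) hup)
  calc 1 + S.M1 p * S.Cg * S.G x a b
      ≤ Real.exp (alpha p * u ^ p) * (S.critConst * (1 / 2) * (u + u ^ p) + 1) := by linarith
    _ ≤ Real.exp (alpha p * u ^ p) * Real.exp (S.critConst * (1 / 2) * (u + u ^ p)) := by
        gcongr
        exact Real.add_one_le_exp _
    _ ≤ _ := by
        rw [← Real.exp_add, Real.exp_le_exp]
        have h3 : alpha p * u ^ p ≤ S.critConst * (1 / 2) * u ^ p := by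
          gcongr
          linarith [alpha_le hp]
        have h4 : 0 ≤ S.critConst * u := by positivity
        linarith

/-- `H` enters each term of the series only once, so any rate `B` will do. Powers of `v` are
absorbed using `v ≤ 1 + v ^ p` and `2 * p - 1 ≤ 3`. -/
theorem exists_H_le (hp : p ∈ Ioo (1 : ℝ) 2) :
    ∃ A B : ℝ, 0 ≤ A ∧ 0 ≤ B ∧ ∀ (x : PathSpace p m) (a b : ℝ), b - a = 1 →
      S.H x a b ≤ A * Real.exp (B * x.var a b ^ p) := by
  have hp0 : 0 < p := by linarith [hp.1]
  have hk := S.kap_nonneg hp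
  have hα := alpha_nonneg hp
  set D := (2 : ℝ) ^ ((p - 1) / p) * ((1 + S.kap p ^ (2 * p - 1)) * Real.exp 3) *
    (Real.exp (alpha p) * Real.exp (2 * S.L)) with hD
  set B := 3 + alpha p * S.kap p ^ p with hB
  have hD0 : 0 ≤ D := by positivity
  refine ⟨2 + D, 1 + B, by positivity, by positivity, fun x a b hab => ?_⟩
  have hv := var_nonneg x a b
  set v := x.var a b with hvdef
  have hw : 0 ≤ v ^ p := by positivity
  have hvw : v ≤ 1 + v ^ p := by
    rcases le_total v 1 with h | h
    · linarith
    · linarith [Real.self_le_rpow_of_one_le h hp.1.le]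
  have hve : v ≤ Real.exp (v ^ p) := by linarith [Real.add_one_le_exp (v ^ p)]
  have hv3 : v ^ (2 * p - 1) ≤ Real.exp 3 * Real.exp (3 * v ^ p) := by
    calc v ^ (2 * p - 1) ≤ (1 + v) ^ (2 * p - 1) := by
          gcongr
          · linarith [hp.1]
          · linarith
      _ ≤ (1 + v) ^ (3 : ℝ) := by
          gcongr
          · linarith
          · linarith [hp.2]
      _ ≤ Real.exp v ^ (3 : ℝ) := by
          gcongr
          linarith [Real.add_one_le_exp v]
      _ = Real.exp (3 * v) := by rw [← Real.exp_mul, mul_comm]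
      _ ≤ _ := by
          rw [← Real.exp_add, Real.exp_le_exp]
          linarith
  have h1 : 1 ≤ Real.exp 3 * Real.exp (3 * v ^ p) := by
    rw [← Real.exp_add]
    exact Real.one_le_exp (by positivity)
  have hlam : S.Lam2 x a b ≤ D * Real.exp (B * v ^ p) := by
    rw [Lam2, F_eq x a b hab, ← hvdef]
    have h2 : 1 + S.kap p ^ (2 * p - 1) * v ^ (2 * p - 1) ≤
        (1 + S.kap p ^ (2 * p - 1)) * (Real.exp 3 * Real.exp (3 * v ^ p)) := by
      have := mul_le_mul_of_nonneg_left hv3 (show 0 ≤ S.kap p ^ (2 * p - 1) by positivity)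
      linarith
    calc _ ≤ (2 : ℝ) ^ ((p - 1) / p) *
          ((1 + S.kap p ^ (2 * p - 1)) * (Real.exp 3 * Real.exp (3 * v ^ p))) *
          (Real.exp (alpha p) * Real.exp (alpha p * (S.kap p ^ p * v ^ p)) *
            Real.exp (2 * S.L)) := by gcongr
      _ = D * (Real.exp (3 * v ^ p) * Real.exp (alpha p * (S.kap p ^ p * v ^ p))) := by
          rw [hD]
          ring
      _ = _ := by
          rw [← Real.exp_add, hB]
          ring_nf
  have hB0 : 1 ≤ Real.exp (B * v ^ p) := Real.one_le_exp (by positivity)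
  have hE : 1 ≤ Real.exp (v ^ p) := Real.one_le_exp hw
  calc S.H x a b = 1 + v * (1 + S.Lam2 x a b) := rfl
    _ ≤ 1 + Real.exp (v ^ p) * (1 + D * Real.exp (B * v ^ p)) := by
        have := S.Lam2_nonneg hp x a b
        gcongr
    _ ≤ Real.exp (v ^ p) * Real.exp (B * v ^ p) +
        Real.exp (v ^ p) * (Real.exp (B * v ^ p) + D * Real.exp (B * v ^ p)) := by
        gcongr
        exact one_le_mul_of_one_le_of_one_le hE hB0
    _ = (2 + D) * (Real.exp (v ^ p) * Real.exp (B * v ^ p)) := by ring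
    _ = _ := by
        rw [← Real.exp_add]
        ring_nf

/-! ### Regularity of `b` -/

theorem F_shift (x : PathSpace p m) (t a b : ℝ) :
    S.F (shift t x) a b = S.F x (t + a) (t + b) := by
  rw [F, F, var_shift, add_sub_add_left_eq_sub]

theorem G_shift (x : PathSpace p m) (t a b : ℝ) :
    S.G (shift t x) a b = S.G x (t + a) (t + b) := by
  rw [G, G, Lam1, Lam1, F_shift, var_shift]

theorem H_shift (x : PathSpace p m) (t a b : ℝ) :
    S.H (shift t x) a b = S.H x (t + a) (t + b) := by
  rw [H, H, Lam2, Lam2, F_shift, var_shift]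

theorem continuous_F (hp : 1 ≤ p) {a b : ℝ} (hab : a ≤ b) :
    Continuous fun x : PathSpace p m => S.F x a b := by
  have h1 := (Real.continuous_rpow_const (q := p) (by linarith)).comp
    (continuous_var (m := m) hp hab)
  exact Real.continuous_exp.comp (((h1.const_mul _).const_add 1).const_mul _ |>.add_const _)

theorem continuous_G (hp : 1 ≤ p) {a b : ℝ} (hab : a ≤ b) :
    Continuous fun x : PathSpace p m => S.G x a b := by
  have hv := continuous_var (m := m) hp hab
  have h1 := (Real.continuous_rpow_const (q := p - 1) (by linarith)).comp hv
  exact hv.mul (((h1.const_mul _).const_add 1).mul (continuous_F hp hab))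

theorem continuous_H (hp : 1 ≤ p) {a b : ℝ} (hab : a ≤ b) :
    Continuous fun x : PathSpace p m => S.H x a b := by
  have hv := continuous_var (m := m) hp hab
  have h1 := (Real.continuous_rpow_const (q := 2 * p - 1) (by linarith)).comp hv
  exact (hv.mul (((((h1.const_mul _).const_add 1).const_mul _).mul
    (continuous_F hp hab)).const_add 1)).const_add 1

theorem continuous_bTerm (hp : 1 ≤ p) (ε : ℝ) (k : ℕ) :
    Continuous fun x : PathSpace p m => S.bTerm x ε k := by
  unfold bTerm
  simp only [G_shift, H_shift]
  exact ((continuous_H hp (by linarith)).const_mul _).mul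
    (continuous_finsetProd _ fun j _ =>
      ((continuous_G hp (by linarith)).const_mul _).const_add 1)

/-- The supremum over `ε` is uncountable, but each term is continuous in `x`, so `b` is lower
semicontinuous. -/
theorem measurable_b (hp : 1 ≤ p) : Measurable (S.b : PathSpace p m → ℝ≥0∞) := by
  refine LowerSemicontinuous.measurable ?_
  unfold b
  exact lowerSemicontinuous_biSup fun ε _ => lowerSemicontinuous_tsum fun k =>
    (ENNReal.continuous_ofReal.comp (continuous_bTerm hp ε (k + 1))).lowerSemicontinuous

theorem bTerm_pos (hp : p ∈ Ioo (1 : ℝ) 2) (hS : S.SemigroupBounds p) (x : PathSpace p m)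
    (ε : ℝ) (k : ℕ) : 0 < S.bTerm x ε k := by
  refine mul_pos (mul_pos (Real.exp_pos _) (one_pos.trans_le (one_le_H hp _ _ _)))
    (Finset.prod_pos fun j _ => ?_)
  have := mul_nonneg (S.M1_mul_Cg_nonneg hp hS) (S.G_nonneg hp (shift (-(j : ℝ)) x) (-ε) (1 - ε))
  linarith

theorem b_pos (hp : p ∈ Ioo (1 : ℝ) 2) (hS : S.SemigroupBounds p) (x : PathSpace p m) :
    0 < S.b x :=
  (ENNReal.ofReal_pos.2 (bTerm_pos hp hS x 0 1)).trans_le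
    ((ENNReal.le_tsum (f := fun k => ENNReal.ofReal (S.bTerm x 0 (k + 1))) 0).trans
      (le_iSup₂_of_le 0 (by simp) le_rfl))

/-! ### Growth of `b` along an orbit -/

/-- If the factors in `b` along the orbit of `x` are controlled by the increments of a function `J`
which grows linearly with slope less than `λ`, then `b` grows subexponentially along the orbit. -/
theorem exists_b_shift_le (hp : p ∈ Ioo (1 : ℝ) 2) (hS : S.SemigroupBounds p) {x : PathSpace p m}
    {J : ℝ → ℝ} {l A B : ℝ} (hA : 0 ≤ A) (hB : 0 ≤ B) (hl : l < S.lam)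
    (hG : ∀ c, 1 + S.M1 p * S.Cg * S.G x c (c + 1) ≤ Real.exp (J (c + 1) - J c))
    (hH : ∀ c, S.H x c (c + 1) ≤ A * Real.exp (B * (J (c + 1) - J c)))
    (hJ : ∀ δ : ℝ, 0 < δ → ∃ C, ∀ s, |J s - l * s| ≤ δ * |s| + C) {D : ℝ} (hD : 0 < D) :
    ∃ C, 0 ≤ C ∧ ∀ t, S.b (shift t x) ≤ ENNReal.ofReal (C * Real.exp (D * |t|)) := by
  set g := S.lam - l with hg
  have hg0 : 0 < g := sub_pos.2 hl
  -- The errors in `J` contribute `(2 + 2 * B) * δ` per unit of `|t|` and `(1 + 2 * B) * δ` per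
  -- index `k`. The former must fit in `D`, the latter in half of the gap `g`.
  obtain ⟨δ, hδ, hδB⟩ := exists_pos_mul_lt (lt_min hD (half_pos hg0)) (2 + 2 * B)
  have hδD : (2 + 2 * B) * δ ≤ D := hδB.le.trans (min_le_left _ _)
  have hδg : (1 + 2 * B) * δ ≤ g / 2 := by linarith [hδB.le.trans (min_le_right _ _)]
  obtain ⟨C, hC⟩ := hJ δ hδ
  have hprod : ∀ r : ℝ, ∀ k : ℕ, ∏ j ∈ Finset.Icc 1 k,
      (1 + S.M1 p * S.Cg * S.G x (r - j) (r - j + 1)) ≤ Real.exp (J r - J (r - k)) := by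
    intro r k
    induction k with
    | zero => simp
    | succ k ih =>
      rw [Finset.prod_Icc_succ_top (by omega)]
      have h1 := hG (r - (k + 1 : ℕ))
      have h2 : r - ((k + 1 : ℕ) : ℝ) + 1 = r - k := by push_cast; ring
      calc _ ≤ Real.exp (J r - J (r - k)) * Real.exp (J (r - (k + 1 : ℕ) + 1) -
            J (r - (k + 1 : ℕ))) := by
            refine mul_le_mul ih h1 ?_ (Real.exp_pos _).le
            have := mul_nonneg (S.M1_mul_Cg_nonneg hp hS)
              (S.G_nonneg hp x (r - (k + 1 : ℕ)) (r - (k + 1 : ℕ) + 1))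
            linarith
        _ = _ := by
            rw [h2, ← Real.exp_add]
            ring_nf
  set q := Real.exp (-(g / 2)) with hq
  have hq1 : q < 1 := by
    rw [hq, ← Real.exp_zero]
    exact Real.exp_lt_exp.2 (by linarith)
  -- Everything in the exponent independent of `t` and `k`; `-S.lam` is there because the series
  -- starts at index `1`.
  set E := -S.lam + 2 * δ + 2 * C + B * (l + 3 * δ + 2 * C) with hE
  have hterm : ∀ t ε : ℝ, ε ∈ Icc (0 : ℝ) 1 → ∀ k : ℕ,
      S.bTerm (shift t x) ε (k + 1) ≤ A * Real.exp E * Real.exp (D * |t|) * q ^ k := by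
    intro t ε hε k
    set r := t - ε with hr
    have hwin : ∀ j : ℝ, -j + t + -ε = r - j ∧ -j + t + (1 - ε) = r - j + 1 := fun j =>
      ⟨by rw [hr]; ring, by rw [hr]; ring⟩
    have hrt : |r| ≤ |t| + 1 := by
      refine (abs_sub _ _).trans ?_
      rw [abs_of_nonneg hε.1]
      linarith [hε.2]
    have hk0 : (0 : ℝ) ≤ k := Nat.cast_nonneg k
    have hrk : |r - k| ≤ |t| + 1 + k := by
      refine (abs_sub _ _).trans ?_
      rw [abs_of_nonneg hk0]
      linarith
    have hrk1 : |r - (k + 1 : ℕ)| ≤ |t| + 2 + k := by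
      refine (abs_sub _ _).trans ?_
      rw [Nat.abs_cast]
      push_cast
      linarith
    have hb0 := abs_le.1 (hC r)
    have hb1 := abs_le.1 (hC (r - k))
    have hb2 := abs_le.1 (hC (r - (k + 1 : ℕ)))
    have hi1 : J r - J (r - k) ≤ l * k + δ * (2 * |t| + 2 + k) + 2 * C := by
      have := mul_le_mul_of_nonneg_left (add_le_add hrt hrk) hδ.le
      linarith [hb0.2, hb1.1]
    have hi2 : J (r - k) - J (r - (k + 1 : ℕ)) ≤ l + δ * (2 * |t| + 2 * k + 3) + 2 * C := by
      have := mul_le_mul_of_nonneg_left (add_le_add hrk hrk1) hδ.le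
      have h3 : l * (r - (k + 1 : ℕ)) = l * (r - k) - l := by push_cast; ring
      linarith [hb1.2, hb2.1]
    have hHb : S.H x (r - (k + 1 : ℕ)) (r - (k + 1 : ℕ) + 1) ≤
        A * Real.exp (B * (l + δ * (2 * |t| + 2 * k + 3) + 2 * C)) := by
      refine (hH _).trans ?_
      have h2 : r - ((k + 1 : ℕ) : ℝ) + 1 = r - k := by push_cast; ring
      rw [h2]
      gcongr
    have hPb := (hprod r k).trans (Real.exp_le_exp.2 hi1)
    unfold bTerm
    simp only [G_shift, H_shift, shift_shift, hwin, Nat.add_sub_cancel]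
    calc _ ≤ Real.exp (-S.lam * (k + 1 : ℕ)) *
          (A * Real.exp (B * (l + δ * (2 * |t| + 2 * k + 3) + 2 * C))) *
          Real.exp (l * k + δ * (2 * |t| + 2 + k) + 2 * C) := by
          refine mul_le_mul (mul_le_mul_of_nonneg_left hHb (Real.exp_pos _).le) hPb
            (Finset.prod_nonneg fun j _ => ?_) (by positivity)
          have := mul_nonneg (S.M1_mul_Cg_nonneg hp hS) (S.G_nonneg hp x (r - j) (r - j + 1))
          linarith
      _ = A * Real.exp (-S.lam * (k + 1 : ℕ) + B * (l + δ * (2 * |t| + 2 * k + 3) + 2 * C) +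
          (l * k + δ * (2 * |t| + 2 + k) + 2 * C)) := by
          rw [Real.exp_add _ (l * k + δ * (2 * |t| + 2 + k) + 2 * C), Real.exp_add (-S.lam * _)]
          ring
      _ ≤ A * Real.exp (E + D * |t| + k * -(g / 2)) := by
          refine mul_le_mul_of_nonneg_left (Real.exp_le_exp.2 ?_) hA
          have h1 := mul_le_mul_of_nonneg_right hδD (abs_nonneg t)
          have h2 := mul_le_mul_of_nonneg_right hδg hk0
          rw [hE]
          push_cast
          have h3 : g * k = S.lam * k - l * k := by rw [hg]; ring
          linarith
      _ = _ := by
          rw [Real.exp_add, Real.exp_add, hq, ← Real.exp_nat_mul]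
          ring
  have hq0 : 0 < q := Real.exp_pos _
  refine ⟨A * Real.exp E * (1 - q)⁻¹, mul_nonneg (by positivity)
    (inv_nonneg.2 (by linarith)), fun t => iSup₂_le fun ε hε => ?_⟩
  have hsum := hasSum_geometric_of_lt_one hq0.le hq1
  calc ∑' k : ℕ, ENNReal.ofReal (S.bTerm (shift t x) ε (k + 1))
      ≤ ∑' k : ℕ, ENNReal.ofReal (A * Real.exp E * Real.exp (D * |t|) * q ^ k) :=
        ENNReal.tsum_le_tsum fun k => ENNReal.ofReal_le_ofReal (hterm t ε hε k)
    _ = ENNReal.ofReal (∑' k : ℕ, A * Real.exp E * Real.exp (D * |t|) * q ^ k) :=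
        (ENNReal.ofReal_tsum_of_nonneg (fun k => by positivity)
          (hsum.summable.mul_left _)).symm
    _ = _ := by
        rw [tsum_mul_left, hsum.tsum_eq]
        ring_nf

end Coeffs

/-- Subexponential growth along an orbit, in the form of `IsTempered`. -/
theorem tendsto_posLog_of_subexponential {ρ : ℝ → ℝ≥0∞}
    (h : ∀ D : ℝ, 0 < D → ∃ C, 0 ≤ C ∧ ∀ t, ρ t ≤ ENNReal.ofReal (C * Real.exp (D * |t|)))
    {F : Filter ℝ} (hF : Tendsto (fun t : ℝ => |t|) F atTop) :
    Tendsto (fun t : ℝ => 1 / t * Real.posLog (ρ t).toReal) F (𝓝 0) := by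
  rw [Metric.tendsto_nhds]
  intro η hη
  obtain ⟨C, hC, hb⟩ := h (η / 2) (half_pos hη)
  have hlim : Tendsto (fun t : ℝ => Real.posLog C / |t|) F (𝓝 0) :=
    Tendsto.div_atTop tendsto_const_nhds hF
  filter_upwards [hlim.eventually_lt_const (half_pos hη), hF.eventually_gt_atTop 0] with t h1 h2
  have h3 : Real.posLog (ρ t).toReal ≤ Real.posLog C + η / 2 * |t| := by
    refine (Real.posLog_le_posLog ENNReal.toReal_nonneg
      (ENNReal.toReal_le_of_le_ofReal (by positivity) (hb t))).trans ?_
    refine Real.posLog_mul.trans (add_le_add_right (le_of_eq ?_) _)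
    rw [Real.posLog, Real.log_exp]
    exact max_eq_right (by positivity)
  rw [dist_zero_right, Real.norm_eq_abs, abs_mul, abs_of_nonneg Real.posLog_nonneg, abs_div,
    abs_one]
  calc 1 / |t| * Real.posLog (ρ t).toReal ≤ 1 / |t| * (Real.posLog C + η / 2 * |t|) := by gcongr
    _ = Real.posLog C / |t| + η / 2 := by field_simp
    _ < η := by linarith

/-! ### The observable dominating the factors of `b` -/

section Observable

variable {p : ℝ} {m : ℕ}

/-- For bounded `s` all windows `[s-1, s+1]` lie in one compact interval, whose variation bounds the
integrand. -/
theorem intervalIntegrable_var_shift (hp : 1 ≤ p) {a₀ b₀ : ℝ} (ha₀ : 0 ≤ a₀) (hb₀ : 0 ≤ b₀)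
    (x : PathSpace p m) (a b : ℝ) :
    IntervalIntegrable (fun s => a₀ * (shift s x).var (-1) 1 ^ p + b₀ * (shift s x).var (-1) 1)
      volume a b := by
  have hp0 : 0 ≤ p := by linarith
  have hm : Measurable fun s => (shift s x).var (-1) 1 :=
    Measurable.of_uncurry_right (f := fun s (x : PathSpace p m) => (shift s x).var (-1) 1)
      (measurable_var_shift hp)
  have hM : Measurable fun s => a₀ * (shift s x).var (-1) 1 ^ p + b₀ * (shift s x).var (-1) 1 :=
    ((hm.pow_const p).const_mul a₀).add (hm.const_mul b₀)
  obtain ⟨V, hV⟩ : ∃ V, ∀ s ∈ uIoc a b, (shift s x).var (-1) 1 ≤ V :=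
    ⟨x.var (min a b + -1) (max a b + 1), fun s hs => by
      rw [var_shift]
      exact var_mono hp0 x (by linarith [hs.1]) (by linarith [hs.2]) (by linarith)⟩
  rw [intervalIntegrable_iff]
  refine Measure.integrableOn_of_bounded (M := a₀ * V ^ p + b₀ * V) (by simp [uIoc])
    hM.aestronglyMeasurable ((ae_restrict_iff' measurableSet_uIoc).2 (ae_of_all _ fun s hs => ?_))
  have hv0 := var_nonneg (shift s x) (-1) 1
  have hv := hV s hs
  rw [Real.norm_of_nonneg (by positivity)]
  gcongr

/-- For `s` in `[c, c+1]` the window `[s-1, s+1]` contains `[c, c+1]`; this is why the moment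
condition concerns `[-1, 1]`. -/
theorem var_le_intervalIntegral (hp : 1 ≤ p) {a₀ b₀ : ℝ} (ha₀ : 0 ≤ a₀) (hb₀ : 0 ≤ b₀)
    (x : PathSpace p m) (c : ℝ) :
    a₀ * x.var c (c + 1) ^ p + b₀ * x.var c (c + 1) ≤
      ∫ s in c..(c + 1), (a₀ * (shift s x).var (-1) 1 ^ p + b₀ * (shift s x).var (-1) 1) := by
  have hp0 : 0 ≤ p := by linarith
  calc _ = ∫ _ in c..(c + 1), (a₀ * x.var c (c + 1) ^ p + b₀ * x.var c (c + 1)) := by simp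
    _ ≤ _ := by
      refine intervalIntegral.integral_mono_on (by linarith) (by simp)
        (intervalIntegrable_var_shift hp ha₀ hb₀ x _ _) fun s hs => ?_
      have hv0 := var_nonneg x c (c + 1)
      have hv : x.var c (c + 1) ≤ (shift s x).var (-1) 1 := by
        rw [var_shift]
        exact var_mono hp0 x (by linarith [hs.2]) (by linarith [hs.1]) (by linarith)
      gcongr

end Observable

/-- The criterion makes the mean of the dominating observable smaller than `λ`, so the ergodic
theorem feeds `exists_b_shift_le`. -/
theorem Coeffs.ae_exists_b_shift_le {d m : ℕ} {p : ℝ} (hp : p ∈ Ioo (1 : ℝ) 2) {S : Coeffs d m}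
    (hS : S.SemigroupBounds p) {P : Measure (PathSpace p m)} [IsProbabilityMeasure P]
    (hP : IsErgodicShift P) (hGam : Gam P < ∞) (hcrit : S.Criterion p (Gam P).toReal) :
    ∀ᵐ x ∂P, ∀ D : ℝ, 0 < D →
      ∃ C, 0 ≤ C ∧ ∀ t, S.b (shift t x) ≤ ENNReal.ofReal (C * Real.exp (D * |t|)) := by
  have hp1 := hp.1.le
  have hk := S.kap_nonneg hp
  have hC := one_le_critConst hS
  have hΓ : 0 ≤ (Gam P).toReal := ENNReal.toReal_nonneg
  have hcrit' : S.critConst * (S.kap p ^ p * (Gam P).toReal ^ p + S.kap p * (Gam P).toReal) <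
      S.lam := by
    rw [← Real.mul_rpow hk hΓ]
    exact hcrit
  -- The slack in the strict criterion is spent on an extra `η * v ^ p` in the observable. It makes
  -- increments of `J` dominate `v ^ p` even when `kap` vanishes, which gives the rate `B / η` for
  -- `H`.
  obtain ⟨η, hη, hη'⟩ := exists_pos_mul_lt (sub_pos.2 hcrit') ((Gam P).toReal ^ p)
  set a₀ := S.critConst * S.kap p ^ p + η with ha₀
  set b₀ := S.critConst * S.kap p with hb₀
  have ha₀0 : 0 ≤ a₀ := by positivity
  have hb₀0 : 0 ≤ b₀ := by positivity
  set ψ : PathSpace p m → ℝ := fun x => a₀ * x.var (-1) 1 ^ p + b₀ * x.var (-1) 1 with hψ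
  have hi1 := (integrable_var_rpow hp.1 hGam).const_mul a₀
  have hi2 := (integrable_var hp.1 hGam).const_mul b₀
  have hmean : ∫ x, ψ x ∂P < S.lam := by
    rw [hψ, integral_add hi1 hi2, integral_const_mul, integral_const_mul, integral_var_rpow hp.1]
    have := mul_le_mul_of_nonneg_left (integral_var_le hp.1 hGam) hb₀0
    calc _ ≤ a₀ * (Gam P).toReal ^ p + b₀ * (Gam P).toReal := by linarith
      _ < S.lam := by
        rw [ha₀, hb₀]
        linarith
  have hm := measurable_var_shift (m := m) hp1
  have herg := hP.isErgodicFlow.ae_forall_intervalIntegral_bounds (ψ := ψ)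
    (fun x => by have := var_nonneg x (-1) 1; positivity) (hi1.add hi2)
    (((hm.pow_const p).const_mul a₀).add (hm.const_mul b₀))
    (intervalIntegrable_var_shift hp1 ha₀0 hb₀0)
  obtain ⟨A, B, hA, hB, hH⟩ := S.exists_H_le hp
  filter_upwards [herg] with x hx D hD
  have hincr : ∀ c, a₀ * x.var c (c + 1) ^ p + b₀ * x.var c (c + 1) ≤
      (∫ s in (0 : ℝ)..(c + 1), ψ (shift s x)) - ∫ s in (0 : ℝ)..c, ψ (shift s x) := fun c => by
    rw [intervalIntegral.integral_interval_sub_left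
      (intervalIntegrable_var_shift hp1 ha₀0 hb₀0 x _ _)
      (intervalIntegrable_var_shift hp1 ha₀0 hb₀0 x _ _)]
    exact var_le_intervalIntegral hp1 ha₀0 hb₀0 x c
  refine exists_b_shift_le hp hS (J := fun s => ∫ r in (0 : ℝ)..s, ψ (shift r x)) (B := B / η)
    hA (by positivity) hmean (fun c => ?_) (fun c => ?_) hx hD
  · refine (one_add_mul_G_le hp hS x c (c + 1) (by ring)).trans (Real.exp_le_exp.2 ?_)
    refine le_trans ?_ (hincr c)
    have := mul_nonneg hη.le (Real.rpow_nonneg (var_nonneg x c (c + 1)) p)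
    rw [ha₀, hb₀]
    linarith
  · refine (hH x c (c + 1) (by ring)).trans ?_
    refine mul_le_mul_of_nonneg_left (Real.exp_le_exp.2 ?_) hA
    rw [div_mul_eq_mul_div, mul_div_assoc]
    refine mul_le_mul_of_nonneg_left ((le_div_iff₀ hη).2 ((le_trans ?_ (hincr c)))) hB
    have hv := var_nonneg x c (c + 1)
    have h1 : 0 ≤ S.critConst * S.kap p ^ p * x.var c (c + 1) ^ p := by positivity
    have h2 : 0 ≤ b₀ * x.var c (c + 1) := by positivity
    rw [ha₀]
    linarith

end YoungRDS

theorem proposition3 {d m : ℕ} (p : ℝ) (hp : p ∈ Set.Ioo (1 : ℝ) 2)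
    (S : YoungRDS.Coeffs d m) (hA : S.Stable) (hfg : S.Regular) (hPhi : S.SemigroupBounds p)
    (P : Measure (YoungRDS.PathSpace p m)) [IsProbabilityMeasure P]
    (hP : YoungRDS.IsErgodicShift P) (hGam : YoungRDS.Gam P < ∞)
    (hcrit : S.Criterion p (YoungRDS.Gam P).toReal) :
    Measurable (S.b : YoungRDS.PathSpace p m → ℝ≥0∞) ∧
      (∀ᵐ x ∂P, S.b x < ∞) ∧
      YoungRDS.IsTempered P (S.b : YoungRDS.PathSpace p m → ℝ≥0∞) := by
  have key := YoungRDS.Coeffs.ae_exists_b_shift_le hp hPhi hP hGam hcrit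
  refine ⟨YoungRDS.Coeffs.measurable_b hp.1.le, ?_, YoungRDS.Coeffs.b_pos hp hPhi, ?_⟩
  · filter_upwards [key] with x hx
    obtain ⟨C, -, hC⟩ := hx 1 one_pos
    simpa [YoungRDS.shift_zero] using (hC 0).trans_lt ENNReal.ofReal_lt_top
  · filter_upwards [key] with x hx
    refine ⟨fun t => ?_, YoungRDS.tendsto_posLog_of_subexponential hx tendsto_abs_atTop_atTop,
      YoungRDS.tendsto_posLog_of_subexponential hx tendsto_abs_atBot_atTop⟩
    obtain ⟨C, -, hC⟩ := hx 1 one_pos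
    exact (hC t).trans_lt ENNReal.ofReal_lt_top
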